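/- **Setting.** Let $\mathcal H$ be a separable infinite-dimensional real Hilbert space, $B>0$ a bounded self-adjoint strictly positive operator on $\mathcal H$, and $\mu_B$ the Gaussian Borel probability measure on $\mathcal H$ with mean $0$ and covariance operator $B$, i.e. $\int_{\mathcal H} e^{i\langle x,y\rangle}\,d\mu_B(x)=e^{-\frac12\langle By,y\rangle}$ for all $y\in\mathcal H$ (so $B$ is necessarily nuclear). Let $\mathcal H_0:=B^{1/2}\mathcal H$ with the inner product $\langle x,y\rangle_0:=\langle B^{-1/2}x,B^{-1/2}y\rangle$ and norm $\|\cdot\|_0$. Let $l:\mathcal H_0\to L^2(\mathcal H,\mu_B)$ be the continuous extension of the isometry that sends $Bu$ to the functional $x\mapsto\langle u,x\rangle$ ($u\in\mathcal H$), and put $\exp_h:=e^{\,l_h-\frac12\|h\|_0^2}$ for $h\in\mathcal H_0$; these functions are total in $L^2(\mathcal H,\mu_B)$. Let $\mathrm{Aff}(\mathcal H_0)=\mathcal H_0\rtimes\mathcal O(\mathcal H_0)$ be the group of affine isometries $(f,V):h\mapsto f+Vh$ of $\mathcal H_0$, with $(f,V)(f',V')=(f+Vf',VV')$. The Weyl operator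 $W_{(f,V)}$ is the unitary operator of $L^2(\mathcal H,\mu_B)$ with $$W_{(f,V)}\exp_h=e^{-\langle f,Vh\rangle_0-\frac12\|f\|_0^2}\exp_{f+Vh},\qquad h\in\mathcal H_0 .$$ The nonsingular Gaussian transformation $T_{(f,V)}$ is the invertible Borel transformation of $\mathcal H$, determined up to $\mu_B$-null sets, for which $\mu_B\circ T_{(f,V)}^{-1}$ is equivalent to $\mu_B$ and $U_{T_{(f,V)}}=W_{(f/2,V)}$, where $U_T\varphi:=\varphi\circ T^{-1}\sqrt{\frac{d\mu_B\circ T^{-1}}{d\mu_B}}$ is the Koopman operator of $T$. **Theorem 3.9.** Let $(f,V)\in\mathrm{Aff}(\mathcal H_0)$, and for $n\in\mathbb Z$ define $f^{(n)}\in\mathcal H_0$ by $(f,V)^n=(f^{(n)},V^n)$. Then the transformation $T_{(f,V)}$ exists, and the following are equivalent (for every version of $T_{(f,V)}$): (i) $T_{(f,V)}$ admits an invariant probability measure that is equivalent to $\mu_B$; (ii) $f$ is a $V$-coboundary, i.e. $f=a-Va$ for some $a\in\mathcal H_0$; (iii) the affine isometry $(f,V)$ has a fixed point, i.e. $f+Va=a$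 for some $a\in\mathcal H_0$; (iv) the sequence $(f^{(n)})_{n\in\mathbb Z}$ is bounded in $\mathcal H_0$. -/

import Mathlib

open MeasureTheory
open scoped RealInnerProductSpace

namespace NonsingularGaussian

section SquareRoot

variable {H : Type*} [NormedAddCommGroup H] [InnerProductSpace ℝ H] [CompleteSpace H]

/-- For a self-adjoint contraction `S`, the equation `(1 - Y) ^ 2 = 1 - S` has a self-adjoint
solution `Y` with `‖Y‖ ≤ 1`. -/
theorem exists_sqrt_one_sub (S : H →L[ℝ] H) (hS : IsSelfAdjoint S) (hS1 : ‖S‖ ≤ 1) :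
    ∃ Y : H →L[ℝ] H, IsSelfAdjoint Y ∧ ‖Y‖ ≤ 1 ∧ (1 - Y) * (1 - Y) = 1 - S := by
  let F : (H →L[ℝ] H) → (H →L[ℝ] H) := fun Y => (2⁻¹ : ℝ) • (S + Y * Y)
  let Y : ℕ → (H →L[ℝ] H) := fun n => F^[n] 0
  let t : ℕ → ℝ := fun n => (fun s : ℝ => 2⁻¹ * (1 + s * s))^[n] 0
  have hY : ∀ n, Y (n + 1) = (2⁻¹ : ℝ) • (S + Y n * Y n) := fun n => by
    simp only [Y, Function.iterate_succ_apply', F]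
  have ht : ∀ n, t (n + 1) = 2⁻¹ * (1 + t n * t n) := fun n => by
    simp only [t, Function.iterate_succ_apply']
  have hY0 : Y 0 = 0 := rfl
  have ht0 : t 0 = 0 := rfl
  have htb : ∀ n, 0 ≤ t n ∧ t n ≤ 1 := by
    intro n
    induction n with
    | zero => simp [ht0]
    | succ n ih => rw [ht]; constructor <;> nlinarith [ih.1, ih.2]
  have hYt : ∀ n, ‖Y n‖ ≤ t n := by
    intro n
    induction n with
    | zero => simp [hY0, ht0]
    | succ n ih =>
      rw [hY, ht, norm_smul, Real.norm_of_nonneg (by norm_num)]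
      have h1 : ‖S + Y n * Y n‖ ≤ ‖S‖ + ‖Y n‖ * ‖Y n‖ :=
        (norm_add_le _ _).trans (by gcongr; exact norm_mul_le _ _)
      have h2 : ‖Y n‖ * ‖Y n‖ ≤ t n * t n := by gcongr; exact (htb n).1
      nlinarith
  have hstep : ∀ n, ‖Y (n + 1) - Y n‖ ≤ t (n + 1) - t n := by
    intro n
    induction n with
    | zero =>
      rw [hY0, ht0, sub_zero, sub_zero]; exact hYt 1
    | succ n ih =>
      have e : Y (n + 1 + 1) - Y (n + 1)
          = (2⁻¹ : ℝ) • (Y (n + 1) * (Y (n + 1) - Y n) + (Y (n + 1) - Y n) * Y n) := by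
        have e0 : Y (n + 1 + 1) - Y (n + 1)
            = (2⁻¹ : ℝ) • (S + Y (n + 1) * Y (n + 1)) - (2⁻¹ : ℝ) • (S + Y n * Y n) :=
          congrArg₂ _ (hY (n + 1)) (hY n)
        rw [e0, ← smul_sub]
        congr 1
        noncomm_ring
      have e' : t (n + 1 + 1) - t (n + 1)
          = 2⁻¹ * (t (n + 1) * (t (n + 1) - t n) + (t (n + 1) - t n) * t n) := by
        have e0 : t (n + 1 + 1) - t (n + 1)
            = 2⁻¹ * (1 + t (n + 1) * t (n + 1)) - 2⁻¹ * (1 + t n * t n) :=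
          congrArg₂ _ (ht (n + 1)) (ht n)
        rw [e0]; ring
      rw [e, e', norm_smul, Real.norm_of_nonneg (by norm_num)]
      gcongr
      refine (norm_add_le _ _).trans (add_le_add ?_ ?_)
      · refine (norm_mul_le _ _).trans ?_
        gcongr
        · exact (htb _).1
        · exact hYt _
      · refine (norm_mul_le _ _).trans ?_
        have := (norm_nonneg _).trans ih
        gcongr
        exact hYt _
  have htsum : Summable fun n => t (n + 1) - t n := by
    refine summable_of_sum_range_le (c := 1) (fun n => (norm_nonneg _).trans (hstep n)) fun n => ?_
    rw [Finset.sum_range_sub, ht0, sub_zero]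
    exact (htb n).2
  have hcau : CauchySeq Y := by
    refine cauchySeq_of_dist_le_of_summable _ (fun n => ?_) htsum
    rw [dist_comm, dist_eq_norm]
    exact hstep n
  obtain ⟨Z, hZ⟩ := cauchySeq_tendsto_of_complete hcau
  have hYsa : ∀ n, IsSelfAdjoint (Y n) := by
    intro n
    induction n with
    | zero => rw [hY0]; exact IsSelfAdjoint.zero _
    | succ n ih =>
      rw [hY]
      refine IsSelfAdjoint.smul (by simp [IsSelfAdjoint]) (hS.add ?_)
      simpa [pow_two] using ih.pow 2
  refine ⟨Z, ?_, ?_, ?_⟩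
  · have h1 := (continuous_star.tendsto Z).comp hZ
    refine tendsto_nhds_unique h1 (hZ.congr fun n => ?_)
    exact (hYsa n).symm
  · exact le_of_tendsto hZ.norm (Filter.Eventually.of_forall fun n => (hYt n).trans (htb n).2)
  · have h1 := hZ.comp (Filter.tendsto_add_atTop_nat 1)
    have h2 : Filter.Tendsto (fun n => (2⁻¹ : ℝ) • (S + Y n * Y n)) Filter.atTop
        (nhds ((2⁻¹ : ℝ) • (S + Z * Z))) := (tendsto_const_nhds.add (hZ.mul hZ)).const_smul _
    have h3 : Z = (2⁻¹ : ℝ) • (S + Z * Z) :=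
      tendsto_nhds_unique h1 (h2.congr fun n => (hY n).symm)
    have h4 : (2 : ℝ) • Z = S + Z * Z := by
      conv_lhs => rw [h3]
      rw [smul_smul]; norm_num
    have h5 : (1 - Z) * (1 - Z) = 1 - (2 : ℝ) • Z + Z * Z := by
      rw [two_smul]; noncomm_ring
    rw [h5, h4]; abel

/-- Every bounded positive operator on a real Hilbert space has a positive square root. -/
theorem exists_positive_sqrt (B : H →L[ℝ] H) (hB : B.IsPositive) :
    ∃ R : H →L[ℝ] H, R.IsPositive ∧ R ∘L R = B := by
  set c : ℝ := ‖B‖ + 1 with hc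
  have hc0 : 0 < c := by positivity
  have key : ∀ x, ‖B x‖ ^ 2 ≤ c * ⟪B x, x⟫ := by
    intro x
    have h0 := hB.inner_nonneg_left (x - c⁻¹ • B x)
    have h1 : ⟪B (B x), x⟫ = ‖B x‖ ^ 2 := by
      rw [hB.inner_left_eq_inner_right, real_inner_self_eq_norm_sq]
    have h2 : ⟪B (B x), B x⟫ ≤ c * ‖B x‖ ^ 2 := by
      refine (real_inner_le_norm _ _).trans ?_
      have := B.le_opNorm (B x)
      nlinarith [norm_nonneg (B x), norm_nonneg B]
    simp only [map_sub, map_smul, inner_sub_left, inner_sub_right, real_inner_smul_left,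
      real_inner_smul_right, real_inner_self_eq_norm_sq, h1] at h0
    have h3 : c⁻¹ * (c⁻¹ * ⟪B (B x), B x⟫) ≤ c⁻¹ * ‖B x‖ ^ 2 := by
      gcongr
      rw [inv_mul_le_iff₀ hc0]; exact h2
    have h4 : c⁻¹ * ‖B x‖ ^ 2 ≤ ⟪B x, x⟫ := by linarith
    rwa [inv_mul_le_iff₀ hc0] at h4
  have hS : IsSelfAdjoint (1 - c⁻¹ • B) :=
    (IsSelfAdjoint.one _).sub (IsSelfAdjoint.smul (by simp [IsSelfAdjoint]) hB.isSelfAdjoint)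
  have hS1 : ‖(1 : H →L[ℝ] H) - c⁻¹ • B‖ ≤ 1 := by
    refine ContinuousLinearMap.opNorm_le_bound _ zero_le_one fun x => ?_
    rw [one_mul]
    refine le_of_sq_le_sq ?_ (norm_nonneg x)
    have e : ((1 : H →L[ℝ] H) - c⁻¹ • B) x = x - c⁻¹ • B x := rfl
    rw [e, norm_sub_sq_real, real_inner_smul_right, norm_smul, mul_pow, Real.norm_eq_abs, sq_abs,
      real_inner_comm]
    have h3 : c⁻¹ ^ 2 * ‖B x‖ ^ 2 ≤ c⁻¹ * ⟪B x, x⟫ := by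
      have := mul_le_mul_of_nonneg_left (key x) (by positivity : 0 ≤ c⁻¹ ^ 2)
      refine this.trans_eq ?_
      field_simp
    have h4 : 0 ≤ c⁻¹ * ⟪B x, x⟫ := mul_nonneg (by positivity) (hB.inner_nonneg_left x)
    linarith
  obtain ⟨Y, hYsa, hY1, hY⟩ := exists_sqrt_one_sub _ hS hS1
  refine ⟨Real.sqrt c • (1 - Y), ?_, ?_⟩
  · rw [ContinuousLinearMap.isPositive_iff']
    refine ⟨IsSelfAdjoint.smul (by simp [IsSelfAdjoint]) ((IsSelfAdjoint.one _).sub hYsa),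
      fun x => ?_⟩
    have e : (Real.sqrt c • ((1 : H →L[ℝ] H) - Y)) x = Real.sqrt c • (x - Y x) := rfl
    rw [e, real_inner_smul_left, inner_sub_left, real_inner_self_eq_norm_sq]
    refine mul_nonneg (Real.sqrt_nonneg _) (sub_nonneg.2 ?_)
    refine (real_inner_le_norm _ _).trans ?_
    have := Y.le_of_opNorm_le hY1 x
    nlinarith [norm_nonneg x]
  · change (Real.sqrt c • ((1 : H →L[ℝ] H) - Y)) * (Real.sqrt c • ((1 : H →L[ℝ] H) - Y)) = B
    rw [smul_mul_smul_comm, Real.mul_self_sqrt hc0.le, hY, sub_sub_cancel, smul_smul,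
      mul_inv_cancel₀ hc0.ne', one_smul]

end SquareRoot

noncomputable section

variable {H : Type*} [NormedAddCommGroup H] [InnerProductSpace ℝ H]

/-- Bounded operators `B > 0` on a real Hilbert space: self-adjoint and strictly positive. -/
structure StrictlyPositiveOperator (H : Type*) [NormedAddCommGroup H]
    [InnerProductSpace ℝ H] where
  op : H →L[ℝ] H
  isPositive : op.IsPositive
  inner_pos : ∀ x, x ≠ 0 → 0 < ⟪op x, x⟫

namespace StrictlyPositiveOperator

variable [CompleteSpace H] (B : StrictlyPositiveOperator H)

/-- The (unique) positive square root `B ^ (1/2)`. -/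
def sqrt : H →L[ℝ] H := (exists_positive_sqrt B.op B.isPositive).choose

theorem sqrt_isPositive : B.sqrt.IsPositive :=
  (exists_positive_sqrt B.op B.isPositive).choose_spec.1

theorem sqrt_comp_sqrt : B.sqrt ∘L B.sqrt = B.op :=
  (exists_positive_sqrt B.op B.isPositive).choose_spec.2

theorem sqrt_sqrt_apply (x : H) : B.sqrt (B.sqrt x) = B.op x :=
  congrArg (fun T : H →L[ℝ] H => T x) B.sqrt_comp_sqrt

theorem sqrt_injective : Function.Injective B.sqrt := by
  refine (injective_iff_map_eq_zero B.sqrt).2 fun x hx => ?_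
  by_contra h
  have h1 := B.inner_pos x h
  rw [← B.sqrt_sqrt_apply, hx, map_zero, inner_zero_left] at h1
  exact lt_irrefl _ h1

end StrictlyPositiveOperator

/-- The vector space `H₀ = B ^ (1/2) H`. It is not given the norm of `H`, but the norm
`‖x‖₀ = ‖B ^ (-1/2) x‖` below. -/
def CameronMartin [CompleteSpace H] (B : StrictlyPositiveOperator H) : Type _ :=
  ↥(LinearMap.range B.sqrt.toLinearMap)

namespace CameronMartin

variable [CompleteSpace H] (B : StrictlyPositiveOperator H)

instance : AddCommGroup (CameronMartin B) :=
  inferInstanceAs (AddCommGroup ↥(LinearMap.range B.sqrt.toLinearMap))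

instance : Module ℝ (CameronMartin B) :=
  inferInstanceAs (Module ℝ ↥(LinearMap.range B.sqrt.toLinearMap))

/-- The inclusion of `H₀` into `H`. -/
def incl : CameronMartin B →ₗ[ℝ] H := (LinearMap.range B.sqrt.toLinearMap).subtype

/-- The bijection `B ^ (1/2) : H → H₀`. -/
def ofHilbert : H ≃ₗ[ℝ] CameronMartin B := LinearEquiv.ofInjective B.sqrt.toLinearMap B.sqrt_injective

/-- The norm `‖x‖₀ = ‖B ^ (-1/2) x‖`. -/
instance : NormedAddCommGroup (CameronMartin B) :=
  NormedAddCommGroup.induced (CameronMartin B) H (ofHilbert B).symm.toLinearMap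
    (ofHilbert B).symm.injective

/-- The inner product `⟪x, y⟫₀ = ⟪B ^ (-1/2) x, B ^ (-1/2) y⟫`. -/
instance : InnerProductSpace ℝ (CameronMartin B) where
  norm_smul_le c x := by
    change ‖(ofHilbert B).symm (c • x)‖ ≤ ‖c‖ * ‖(ofHilbert B).symm x‖
    rw [map_smul, norm_smul]
  inner x y := ⟪(ofHilbert B).symm x, (ofHilbert B).symm y⟫
  norm_sq_eq_re_inner x := (real_inner_self_eq_norm_sq ((ofHilbert B).symm x)).symm
  conj_inner_symm x y := real_inner_comm _ _
  add_left x y z := by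
    change ⟪(ofHilbert B).symm (x + y), (ofHilbert B).symm z⟫ = _
    rw [map_add, inner_add_left]
  smul_left x y c := by
    change ⟪(ofHilbert B).symm (c • x), (ofHilbert B).symm y⟫ = _
    rw [map_smul, inner_smul_left]

/-- The operator `B`, viewed as a linear map from `H` to `H₀` (its range `B H` lies in `H₀`). -/
def ofOp : H →ₗ[ℝ] CameronMartin B := (ofHilbert B).toLinearMap ∘ₗ B.sqrt.toLinearMap

theorem incl_ofHilbert (u : H) : incl B (ofHilbert B u) = B.sqrt u := rfl

theorem incl_ofOp (u : H) : incl B (ofOp B u) = B.op u := B.sqrt_sqrt_apply u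

end CameronMartin

/-- The group `Aff(K) = K ⋊ O(K)` of affine isometries `h ↦ f + V h` of `K`. -/
@[ext]
structure Aff (K : Type*) [NormedAddCommGroup K] [InnerProductSpace ℝ K] where
  trans : K
  lin : K ≃ₗᵢ[ℝ] K

namespace Aff

variable {K : Type*} [NormedAddCommGroup K] [InnerProductSpace ℝ K]

instance : Mul (Aff K) := ⟨fun A A' => ⟨A.trans + A.lin A'.trans, A.lin * A'.lin⟩⟩

instance : One (Aff K) := ⟨⟨0, 1⟩⟩

instance : Inv (Aff K) := ⟨fun A => ⟨-(A.lin⁻¹ A.trans), A.lin⁻¹⟩⟩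

instance : Group (Aff K) :=
  Group.ofLeftAxioms
    (fun A A' A'' => by
      refine Aff.ext ?_ (mul_assoc _ _ _)
      change A.trans + A.lin A'.trans + A.lin (A'.lin A''.trans)
        = A.trans + A.lin (A'.trans + A'.lin A''.trans)
      rw [map_add, add_assoc])
    (fun A => by
      refine Aff.ext ?_ (one_mul _)
      change 0 + A.trans = A.trans
      rw [zero_add])
    (fun A => by
      refine Aff.ext ?_ (inv_mul_cancel _)
      change -(A.lin⁻¹ A.trans) + A.lin⁻¹ A.trans = 0
      rw [neg_add_cancel])

/-- The action on `K`: `A h = f + V h` for `A = (f, V)`. -/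
def act (A : Aff K) (h : K) : K := A.trans + A.lin h

/-- The map `(f, V) ↦ (t f, V)`. -/
def scale (t : ℝ) (A : Aff K) : Aff K := ⟨t • A.trans, A.lin⟩

end Aff

/-- `f` is a `V`-coboundary: `f = a - V a` for some `a`. -/
def IsCoboundary {K : Type*} [NormedAddCommGroup K] [InnerProductSpace ℝ K]
    (V : K ≃ₗᵢ[ℝ] K) (f : K) : Prop :=
  ∃ a : K, f = a - V a

section Measure

variable [MeasurableSpace H]

/-- `μ` is the Gaussian measure `μ_B` with mean zero and covariance operator `B`: a probability
measure with characteristic functional `y ↦ exp (-⟪B y, y⟫ / 2)`. -/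
structure IsGaussianMeasure (B : StrictlyPositiveOperator H) (μ : Measure H) : Prop where
  isProbabilityMeasure : IsProbabilityMeasure μ
  charFun_eq : ∀ y : H, charFun μ y = Complex.exp (-(⟪B.op y, y⟫ : ℂ) / 2)

variable [CompleteSpace H] [BorelSpace H]

/-- The map `l : H₀ → L²(H, μ_B)`, the extension by continuity of the map that sends `B u` to the
continuous linear functional `y ↦ ⟪u, y⟫`, from the dense subspace `B H` to `H₀`. -/
def measurableFunctional (B : StrictlyPositiveOperator H) (μ : Measure H) :
    CameronMartin B →L[ℝ] Lp ℝ 2 μ :=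
  ((StrongDual.toLp μ 2).toLinearMap ∘ₗ (innerSL ℝ (E := H)).toLinearMap).extendOfNorm
    (CameronMartin.ofOp B)

/-- The exponential vector `exp_h = exp (l_h - ‖h‖₀² / 2)` as a function on `H`. -/
def expVec (B : StrictlyPositiveOperator H) (μ : Measure H) (h : CameronMartin B) (x : H) : ℝ :=
  Real.exp (measurableFunctional B μ h x - ‖h‖ ^ 2 / 2)

/-- The value `W_A exp_h = exp (-⟪f, V h⟫₀ - ‖f‖₀² / 2) exp_{f + V h}` of the Weyl operator
of `A = (f, V)` at the exponential vector `exp_h`. -/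
def weylExpVec (B : StrictlyPositiveOperator H) (μ : Measure H) (A : Aff (CameronMartin B))
    (h : CameronMartin B) (x : H) : ℝ :=
  Real.exp (-⟪A.trans, A.lin h⟫ - ‖A.trans‖ ^ 2 / 2) *
    expVec B μ (A.trans + A.lin h) x

/-- An invertible Borel transformation is `μ`-nonsingular if `μ ∘ T⁻¹` and `μ` are equivalent. -/
def IsNonsingular (μ : Measure H) (T : H ≃ᵐ H) : Prop :=
  μ.map T ≪ μ ∧ μ ≪ μ.map T

/-- The Koopman operator `U_T φ = φ ∘ T⁻¹ · √(d(μ ∘ T⁻¹)/dμ)`. -/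
def koopman (μ : Measure H) (T : H ≃ᵐ H) (φ : H → ℝ) (x : H) : ℝ :=
  φ (T.symm x) * Real.sqrt (((μ.map T).rnDeriv μ x).toReal)

/-- `T` is (a version of) the nonsingular Gaussian transformation `T_A` generated by
`A ∈ Aff(H₀)`, i.e. an invertible nonsingular Borel transformation whose Koopman operator is the
Weyl operator of `(f / 2, V)`. As the exponential vectors are total in `L²(H, μ_B)`, the two
unitary operators are equal as soon as they agree on the exponential vectors. -/
def IsGaussianTransformation (B : StrictlyPositiveOperator H) (μ : Measure H)
    (A : Aff (CameronMartin B)) (T : H ≃ᵐ H) : Prop :=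
  IsNonsingular μ T ∧
    ∀ h : CameronMartin B, koopman μ T (expVec B μ h) =ᵐ[μ] weylExpVec B μ (A.scale (1 / 2)) h

/-- `T` admits an invariant probability measure that is equivalent to `μ`. -/
def HasEquivInvariantProbability (μ : Measure H) (T : H ≃ᵐ H) : Prop :=
  ∃ ν : Measure H, IsProbabilityMeasure ν ∧ ν ≪ μ ∧ μ ≪ ν ∧ MeasurePreserving T ν ν

end Measure

end

end NonsingularGaussian

/-!
The transformation `T = T_{(f, V)}` is a measurable version of `x ↦ f + V x`. For an orthogonal
operator `V` of `H₀` and a Hilbert basis `bᵢ` of `H`, the variables `l_{V B bᵢ}` have second moments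
`⟪B bᵢ, bᵢ⟫`, and these add up to the second moment of `μ_B`; hence the series `∑ l_{V B bᵢ}(x) bᵢ`
converges almost everywhere and extends `V⁻¹` to `H` (`exists_measurable_inner_eq`). Subtracting
`V⁻¹ f` yields an inverse extension `S` of `(f, V)`. By a computation of moment generating functions,
`S` maps `exp_f μ_B` to `μ_B`, and `l_h ∘ S = l_{V h} - ⟪f, V h⟫₀`. The extensions for `(f, V)` and
its inverse are therefore inverse to each other almost everywhere, and
`exists_measurableEquiv_ae_eq` modifies them on a null set to an invertible Borel transformation:
an uncountable null set, here a hyperplane, gives room to match up the two exceptional sets by the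
Borel isomorphism theorem.

Conversely, the Koopman identity for a version `T` of `T_A` evaluated at `exp_0 = 1` shows that
`μ_B ∘ T⁻¹ = exp_f μ_B`, and then at `exp_h` that `l_h ∘ T⁻¹ = l_{V h} - ⟪f, V h⟫₀`. It follows that
`T` maps `exp_a μ_B` to `exp_{A a} μ_B` (`IsGaussianTransformation.map_shiftMeasure_act`). So a fixed
point `a` of `A` gives the invariant probability measure `exp_a μ_B`. In the other direction,
`μ_B ∘ T⁻ⁿ = exp_{f⁽ⁿ⁾} μ_B`, and the Hellinger affinity of `μ_B` and `exp_h μ_B` is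
`exp (-‖h‖₀² / 8)`. If `f⁽ⁿ⁾` were unbounded, there would be sets `E` for which both `μ_B E` and
`μ_B (T⁻ⁿ Eᶜ)` are arbitrarily small; an invariant probability `ν ≪ μ_B` would then give `E` and its
complement small mass simultaneously. Finally, boundedness of the orbit `f⁽ⁿ⁾ = Aⁿ 0` yields a fixed
point of `A`, the Chebyshev centre of the orbit (`Aff.exists_act_eq_iff_isBounded`).
-/

open MeasureTheory
open scoped RealInnerProductSpace

namespace NonsingularGaussian

open Filter Topology ProbabilityTheory

/-! ### The Cameron–Martin space -/

namespace CameronMartin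

variable {H : Type*} [NormedAddCommGroup H] [InnerProductSpace ℝ H] [CompleteSpace H]
  (B : StrictlyPositiveOperator H)

/-- The operator `B ^ (1/2)` as an isometric isomorphism from `H` onto `H₀`. -/
noncomputable def isometryEquiv : H ≃ₗᵢ[ℝ] CameronMartin B where
  toLinearEquiv := ofHilbert B
  norm_map' u := congrArg norm ((ofHilbert B).symm_apply_apply u)

instance : CompleteSpace (CameronMartin B) :=
  (isometryEquiv B).toIsometryEquiv.symm.completeSpace_iff.2 inferInstance

theorem ofOp_eq (u : H) : ofOp B u = isometryEquiv B (B.sqrt u) := rfl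

theorem incl_isometryEquiv (u : H) : incl B (isometryEquiv B u) = B.sqrt u := rfl

theorem continuous_ofOp : Continuous (ofOp B) :=
  (isometryEquiv B).continuous.comp B.sqrt.continuous

/-- The vector `B u` of `H₀` represents the functional `⟪u, ·⟫` on `H₀`. -/
theorem inner_ofOp (h : CameronMartin B) (u : H) : ⟪h, ofOp B u⟫ = ⟪u, incl B h⟫ := by
  obtain ⟨w, rfl⟩ := (isometryEquiv B).surjective h
  rw [ofOp_eq, LinearIsometryEquiv.inner_map_map, incl_isometryEquiv, real_inner_comm]
  exact B.sqrt_isPositive.inner_left_eq_inner_right u w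

theorem norm_ofOp_sq (u : H) : ‖ofOp B u‖ ^ 2 = ⟪B.op u, u⟫ := by
  rw [← real_inner_self_eq_norm_sq, inner_ofOp, incl_ofOp, real_inner_comm]

theorem denseRange_ofOp : DenseRange (ofOp B) := by
  have h : (LinearMap.range (ofOp B)).topologicalClosure = ⊤ := by
    rw [Submodule.topologicalClosure_eq_top_iff, Submodule.eq_bot_iff]
    intro h hh
    rw [Submodule.mem_orthogonal'] at hh
    obtain ⟨w, rfl⟩ := (isometryEquiv B).surjective h
    have h1 := hh (ofOp B w) ⟨w, rfl⟩
    rw [ofOp_eq, LinearIsometryEquiv.inner_map_map] at h1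
    have h2 : ∀ x, ⟪w, B.sqrt x⟫ = 0 := fun x => by
      rw [← LinearIsometryEquiv.inner_map_map (isometryEquiv B)]
      exact hh _ ⟨x, rfl⟩
    have h3 := h2 (B.sqrt w)
    rw [B.sqrt_sqrt_apply, real_inner_comm] at h3
    by_contra h4
    have h5 := B.inner_pos w (by rintro rfl; exact h4 (map_zero _))
    linarith
  intro x
  have := h ▸ Submodule.mem_top (x := x)
  exact this

end CameronMartin

/-! ### The Gaussian functionals -/

/-- A centred Gaussian variable has second moment equal to its variance. -/
theorem lintegral_ofReal_sq_of_map_eq_gaussianReal {Ω : Type*} [MeasurableSpace Ω]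
    {P : Measure Ω} {X : Ω → ℝ} (hX : AEMeasurable X P)
    {v : NNReal} (h : P.map X = gaussianReal 0 v) :
    ∫⁻ x, ENNReal.ofReal (X x ^ 2) ∂P = v := by
  have h1 : ∫⁻ x, ENNReal.ofReal (X x ^ 2) ∂P
      = ∫⁻ y, ENNReal.ofReal (y ^ 2) ∂(gaussianReal 0 v) := by
    rw [← h, lintegral_map' (by fun_prop) hX]
  have h2 : MemLp id 2 (gaussianReal 0 v) := memLp_id_gaussianReal 2
  have h3 := variance_id_gaussianReal (μ := 0) (v := v)
  rw [variance_of_integral_eq_zero (by fun_prop) (by simp)] at h3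
  have h4 := ofReal_integral_eq_lintegral_ofReal h2.integrable_sq
    (ae_of_all _ fun y => sq_nonneg (id y))
  rw [h3, ENNReal.ofReal_coe_nnreal] at h4
  exact h1.trans h4.symm

section Functional

variable {H : Type*} [NormedAddCommGroup H] [InnerProductSpace ℝ H] [CompleteSpace H]
  [MeasurableSpace H] [BorelSpace H]
  {B : StrictlyPositiveOperator H} {μ : Measure H}

open CameronMartin

theorem aemeasurable_measurableFunctional (h : CameronMartin B) :
    AEMeasurable (measurableFunctional B μ h) μ :=
  (Lp.aestronglyMeasurable _).aemeasurable

theorem measurable_measurableFunctional (h : CameronMartin B) :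
    Measurable (measurableFunctional B μ h) :=
  (Lp.stronglyMeasurable _).measurable

theorem measurableFunctional_add (h k : CameronMartin B) :
    measurableFunctional B μ (h + k) =ᵐ[μ]
      fun x => measurableFunctional B μ h x + measurableFunctional B μ k x := by
  rw [map_add]; exact Lp.coeFn_add _ _

theorem measurableFunctional_smul (c : ℝ) (h : CameronMartin B) :
    measurableFunctional B μ (c • h) =ᵐ[μ] fun x => c * measurableFunctional B μ h x := by
  rw [map_smul]; exact Lp.coeFn_smul _ _

/-- If `h n → h` in `H₀` and the functionals of `h n` converge almost everywhere, then their limit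
is the functional of `h`. -/
theorem measurableFunctional_eq_of_tendsto {h : CameronMartin B} {s : ℕ → CameronMartin B}
    (hs : Tendsto s atTop (𝓝 h)) {g : H → ℝ}
    (hg : ∀ᵐ x ∂μ, Tendsto (fun n => measurableFunctional B μ (s n) x) atTop (𝓝 (g x))) :
    measurableFunctional B μ h =ᵐ[μ] g := by
  have h1 : Tendsto (fun n => measurableFunctional B μ (s n)) atTop
      (𝓝 (measurableFunctional B μ h)) :=
    ((measurableFunctional B μ).continuous.tendsto h).comp hs
  obtain ⟨φ, hφ, h2⟩ := (tendstoInMeasure_of_tendsto_Lp h1).exists_seq_tendsto_ae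
  filter_upwards [hg, h2] with x hx1 hx2
  exact tendsto_nhds_unique hx2 (hx1.comp hφ.tendsto_atTop)

/-- Each functional `l_h` is an almost everywhere limit of continuous linear functionals. -/
theorem exists_seq_ofOp_tendsto (h : CameronMartin B) :
    ∃ u : ℕ → H, Tendsto (fun n => ofOp B (u n)) atTop (𝓝 h) ∧
      ∀ᵐ x ∂μ, Tendsto (fun n => measurableFunctional B μ (ofOp B (u n)) x) atTop
        (𝓝 (measurableFunctional B μ h x)) := by
  obtain ⟨s, hs, hlim⟩ := mem_closure_iff_seq_limit.1 (denseRange_ofOp B h)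
  choose u hu using hs
  have h1 : Tendsto (fun n => measurableFunctional B μ (s n)) atTop
      (𝓝 (measurableFunctional B μ h)) :=
    ((measurableFunctional B μ).continuous.tendsto h).comp hlim
  obtain ⟨φ, hφ, h2⟩ := (tendstoInMeasure_of_tendsto_Lp h1).exists_seq_tendsto_ae
  refine ⟨u ∘ φ, ?_, ?_⟩
  · simpa only [Function.comp_apply, hu] using! hlim.comp hφ.tendsto_atTop
  · simpa only [Function.comp_apply, hu] using h2

theorem measurable_expVec (h : CameronMartin B) : Measurable (expVec B μ h) := by
  have := measurable_measurableFunctional (μ := μ) h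
  unfold expVec
  fun_prop

theorem expVec_pos (h : CameronMartin B) (x : H) : 0 < expVec B μ h x := Real.exp_pos _

variable [SecondCountableTopology H]

theorem IsGaussianMeasure.map_inner (hμ : IsGaussianMeasure B μ) (u : H) :
    μ.map (fun x => ⟪u, x⟫) = gaussianReal 0 (‖ofOp B u‖₊ ^ 2) := by
  have := hμ.isProbabilityMeasure
  have hm : Measurable fun x : H => ⟪u, x⟫ := by fun_prop
  have : IsProbabilityMeasure (μ.map fun x => ⟪u, x⟫) :=
    Measure.isProbabilityMeasure_map hm.aemeasurable
  refine Measure.ext_of_charFun (funext fun t => ?_)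
  have h1 := hμ.charFun_eq (t • u)
  rw [charFun_apply] at h1
  rw [charFun_gaussianReal, charFun_apply_real, integral_map hm.aemeasurable (by fun_prop)]
  convert h1 using 1
  · congr 1
    ext x
    rw [real_inner_smul_right, real_inner_comm]
    push_cast
    rfl
  · congr 1
    rw [map_smul, real_inner_smul_left, real_inner_smul_right, ← norm_ofOp_sq]
    push_cast
    ring

theorem IsGaussianMeasure.isGaussian (hμ : IsGaussianMeasure B μ) : IsGaussian μ := by
  refine isGaussian_of_map_eq_gaussianReal fun L => ?_
  obtain ⟨u, rfl⟩ := (InnerProductSpace.toDual ℝ H).surjective L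
  exact ⟨0, _, hμ.map_inner u⟩

theorem IsGaussianMeasure.memLp_two_id (hμ : IsGaussianMeasure B μ) : MemLp id 2 μ :=
  have := hμ.isGaussian
  IsGaussian.memLp_two_id

theorem norm_toLp_inner (hμ : IsGaussianMeasure B μ) (u : H) :
    ‖StrongDual.toLp μ 2 (innerSL ℝ u)‖ = ‖ofOp B u‖ := by
  rw [StrongDual.toLp_apply hμ.memLp_two_id, Lp.norm_toLp]
  have h := lintegral_ofReal_sq_of_map_eq_gaussianReal (by fun_prop) (hμ.map_inner u)
  rw [eLpNorm_eq_lintegral_rpow_enorm_toReal (by simp) (by simp)]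
  have e : ∀ x : H, ‖(innerSL ℝ u) x‖ₑ ^ (2 : ENNReal).toReal = ENNReal.ofReal (⟪u, x⟫ ^ 2) := by
    intro x
    rw [← sq_abs, ENNReal.ofReal_pow (abs_nonneg _), ← Real.norm_eq_abs, ofReal_norm]
    norm_cast
  simp only [e, h]
  rw [← ENNReal.toReal_rpow]
  simp only [ENNReal.coe_toReal, NNReal.coe_pow, coe_nnnorm, ENNReal.toReal_ofNat]
  rw [← Real.sqrt_eq_rpow, Real.sqrt_sq (norm_nonneg _)]

/-- On `B H`, the functional `l` is given by the inner product of `H`. -/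
theorem measurableFunctional_ofOp (hμ : IsGaussianMeasure B μ) (u : H) :
    measurableFunctional B μ (ofOp B u) =ᵐ[μ] fun x => ⟪u, x⟫ := by
  have h : measurableFunctional B μ (ofOp B u) = StrongDual.toLp μ 2 (innerSL ℝ u) :=
    LinearMap.extendOfNorm_eq (denseRange_ofOp B)
      ⟨1, fun u => by rw [one_mul]; exact (norm_toLp_inner hμ u).le⟩ u
  rw [h, StrongDual.toLp_apply hμ.memLp_two_id]
  exact MemLp.coeFn_toLp _

/-- The functional `l_h` is a centred Gaussian variable of variance `‖h‖₀²`. -/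
theorem map_measurableFunctional (hμ : IsGaussianMeasure B μ) (h : CameronMartin B) :
    μ.map (measurableFunctional B μ h) = gaussianReal 0 (‖h‖₊ ^ 2) := by
  have := hμ.isProbabilityMeasure
  have : IsProbabilityMeasure (μ.map (measurableFunctional B μ h)) :=
    Measure.isProbabilityMeasure_map (aemeasurable_measurableFunctional h)
  refine Measure.ext_of_charFun (funext fun t => ?_)
  have hc : ∀ k : CameronMartin B, charFun (μ.map (measurableFunctional B μ k)) t
      = ∫ x, Complex.exp (t * measurableFunctional B μ k x * Complex.I) ∂μ := fun k => by
    rw [charFun_apply_real, integral_map (aemeasurable_measurableFunctional k) (by fun_prop)]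
  obtain ⟨u, hu, hl⟩ := exists_seq_ofOp_tendsto (μ := μ) h
  have h1 : Tendsto (fun n =>
      ∫ x, Complex.exp (t * measurableFunctional B μ (ofOp B (u n)) x * Complex.I) ∂μ) atTop
      (𝓝 (∫ x, Complex.exp (t * measurableFunctional B μ h x * Complex.I) ∂μ)) := by
    refine tendsto_integral_of_dominated_convergence (fun _ => 1) (fun n => ?_)
      (integrable_const _) (fun n => ae_of_all _ fun x => ?_) ?_
    · have := measurable_measurableFunctional (μ := μ) (ofOp B (u n))
      exact Measurable.aestronglyMeasurable (by fun_prop)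
    · rw [← Complex.ofReal_mul, Complex.norm_exp_ofReal_mul_I]
    · filter_upwards [hl] with x hx
      have hcont : Continuous fun y : ℝ => Complex.exp (t * y * Complex.I) := by fun_prop
      exact (hcont.tendsto _).comp hx
  have h2 : Tendsto (fun n => charFun (gaussianReal 0 (‖ofOp B (u n)‖₊ ^ 2)) t) atTop
      (𝓝 (charFun (gaussianReal 0 (‖h‖₊ ^ 2)) t)) := by
    simp only [charFun_gaussianReal]
    have hcont : Continuous fun k : CameronMartin B => Complex.exp (t * ((0 : ℝ) : ℂ) * Complex.I
        - ((‖k‖₊ ^ 2 : NNReal) : ℂ) * t ^ 2 / 2) := by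
      have : Continuous fun k : CameronMartin B => ((‖k‖₊ ^ 2 : NNReal) : ℂ) := by
        push_cast
        fun_prop
      fun_prop
    exact (hcont.tendsto h).comp hu
  rw [hc]
  refine tendsto_nhds_unique h1 (h2.congr fun n => ?_)
  rw [← hc, ← hμ.map_inner, Measure.map_congr (measurableFunctional_ofOp hμ (u n))]

theorem integrable_exp_measurableFunctional (hμ : IsGaussianMeasure B μ) (h : CameronMartin B) :
    Integrable (fun x => Real.exp (measurableFunctional B μ h x)) μ := by
  have h1 := integrable_exp_mul_gaussianReal (μ := 0) (v := ‖h‖₊ ^ 2) 1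
  rw [← map_measurableFunctional hμ] at h1
  simpa [Function.comp_def] using h1.comp_aemeasurable (aemeasurable_measurableFunctional h)

theorem integral_exp_measurableFunctional (hμ : IsGaussianMeasure B μ) (h : CameronMartin B) :
    ∫ x, Real.exp (measurableFunctional B μ h x) ∂μ = Real.exp (‖h‖ ^ 2 / 2) := by
  have h1 := mgf_gaussianReal (map_measurableFunctional hμ h) 1
  simpa [mgf] using h1

theorem integral_expVec (hμ : IsGaussianMeasure B μ) (h : CameronMartin B) :
    ∫ x, expVec B μ h x ∂μ = 1 := by
  simp only [expVec, Real.exp_sub]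
  rw [integral_div, integral_exp_measurableFunctional hμ, div_self (Real.exp_ne_zero _)]

theorem integrable_expVec (hμ : IsGaussianMeasure B μ) (h : CameronMartin B) :
    Integrable (expVec B μ h) μ := by
  have e : expVec B μ h = fun x => Real.exp (measurableFunctional B μ h x)
      / Real.exp (‖h‖ ^ 2 / 2) := funext fun x => Real.exp_sub _ _
  rw [e]
  exact (integrable_exp_measurableFunctional hμ h).div_const _

end Functional

/-! ### Gaussian densities -/

section Density

variable {H : Type*} [NormedAddCommGroup H] [InnerProductSpace ℝ H] [CompleteSpace H]
  [MeasurableSpace H] [BorelSpace H] {B : StrictlyPositiveOperator H} {μ : Measure H}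

open CameronMartin

/-- A probability measure on `ℝ` with the moment generating function of a Gaussian measure is this
Gaussian measure. -/
theorem eq_gaussianReal_of_mgf_eq {ν : Measure ℝ} [IsProbabilityMeasure ν] {m : ℝ} {v : NNReal}
    (h : ∀ t, mgf id ν t = Real.exp (m * t + v * t ^ 2 / 2)) : ν = gaussianReal m v := by
  have h1 : mgf id ν = mgf id (gaussianReal m v) := by
    rw [mgf_id_gaussianReal]
    exact funext h
  have h2 := integrableExpSet_eq_of_mgf h1
  have h3 := eqOn_complexMGF_of_mgf h1
  rw [h2, integrableExpSet_id_gaussianReal] at h3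
  refine Measure.ext_of_charFun (funext fun t => ?_)
  rw [← complexMGF_id_mul_I, ← complexMGF_id_mul_I]
  exact h3 (by simp)

variable (B μ) in
/-- The measure `exp_h μ_B`, that is, `μ_B` translated by `h`. -/
noncomputable def shiftMeasure (h : CameronMartin B) : Measure H :=
  μ.withDensity fun x => ENNReal.ofReal (expVec B μ h x)

theorem shiftMeasure_absolutelyContinuous (h : CameronMartin B) : shiftMeasure B μ h ≪ μ :=
  withDensity_absolutelyContinuous _ _

theorem absolutelyContinuous_shiftMeasure (h : CameronMartin B) : μ ≪ shiftMeasure B μ h :=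
  withDensity_absolutelyContinuous' (measurable_expVec h).ennreal_ofReal.aemeasurable
    (ae_of_all _ fun x => (ENNReal.ofReal_pos.2 (expVec_pos h x)).ne')

theorem shiftMeasure_congr {h : CameronMartin B} {ρ : H → ENNReal}
    (hρ : ρ =ᵐ[μ] fun x => ENNReal.ofReal (expVec B μ h x)) :
    μ.withDensity ρ = shiftMeasure B μ h :=
  withDensity_congr_ae hρ

theorem shiftMeasure_zero : shiftMeasure B μ 0 = μ := by
  conv_rhs => rw [← withDensity_one (μ := μ)]
  refine withDensity_congr_ae ?_
  have h := measurableFunctional_smul (μ := μ) 0 (0 : CameronMartin B)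
  simp only [zero_smul, zero_mul] at h
  filter_upwards [h] with x hx
  simp only [expVec, hx]
  simp

variable [SecondCountableTopology H]

theorem isProbabilityMeasure_shiftMeasure (hμ : IsGaussianMeasure B μ) (h : CameronMartin B) :
    IsProbabilityMeasure (shiftMeasure B μ h) where
  measure_univ := by
    rw [shiftMeasure, withDensity_apply _ MeasurableSet.univ, Measure.restrict_univ,
      ← ofReal_integral_eq_lintegral_ofReal (integrable_expVec hμ h)
        (ae_of_all _ fun x => (expVec_pos h x).le), integral_expVec hμ, ENNReal.ofReal_one]

/-- Under `exp_h μ_B`, the functional `l_k` is Gaussian with mean `⟪h, k⟫₀` and variance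
`‖k‖₀²`. -/
theorem map_shiftMeasure (hμ : IsGaussianMeasure B μ) (h k : CameronMartin B) :
    (shiftMeasure B μ h).map (measurableFunctional B μ k) = gaussianReal ⟪h, k⟫ (‖k‖₊ ^ 2) := by
  have := isProbabilityMeasure_shiftMeasure hμ h
  have hm := measurable_measurableFunctional (μ := μ) k
  have : IsProbabilityMeasure ((shiftMeasure B μ h).map (measurableFunctional B μ k)) :=
    Measure.isProbabilityMeasure_map hm.aemeasurable
  refine eq_gaussianReal_of_mgf_eq fun t => ?_
  rw [mgf_id_map hm.aemeasurable, mgf, shiftMeasure,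
    integral_withDensity_eq_integral_toReal_smul (measurable_expVec h).ennreal_ofReal
      (ae_of_all _ fun x => ENNReal.ofReal_lt_top)]
  have e : (fun x => (ENNReal.ofReal (expVec B μ h x)).toReal •
        Real.exp (t * measurableFunctional B μ k x)) =ᵐ[μ]
      fun x => Real.exp (measurableFunctional B μ (h + t • k) x) / Real.exp (‖h‖ ^ 2 / 2) := by
    filter_upwards [measurableFunctional_add (μ := μ) h (t • k), measurableFunctional_smul t k]
      with x h1 h2
    rw [ENNReal.toReal_ofReal (expVec_pos h x).le, h1, h2, expVec, smul_eq_mul, ← Real.exp_add,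
      ← Real.exp_sub]
    congr 1
    ring
  rw [integral_congr_ae e, integral_div, integral_exp_measurableFunctional hμ, ← Real.exp_sub]
  congr 1
  rw [norm_add_sq_real, norm_smul, real_inner_smul_right, Real.norm_eq_abs, mul_pow, sq_abs]
  push_cast
  ring

/-- The Hellinger affinity of `μ_B` and `exp_h μ_B` is `exp (-‖h‖₀² / 8)`. -/
theorem lintegral_sqrt_expVec (hμ : IsGaussianMeasure B μ) (h : CameronMartin B) :
    ∫⁻ x, ENNReal.ofReal (Real.sqrt (expVec B μ h x)) ∂μ
      = ENNReal.ofReal (Real.exp (-‖h‖ ^ 2 / 8)) := by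
  have e : (fun x => ENNReal.ofReal (Real.sqrt (expVec B μ h x))) =ᵐ[μ]
      fun x => ENNReal.ofReal (Real.exp (-‖h‖ ^ 2 / 8))
        * ENNReal.ofReal (expVec B μ ((1 / 2 : ℝ) • h) x) := by
    filter_upwards [measurableFunctional_smul (μ := μ) (1 / 2) h] with x hx
    rw [← ENNReal.ofReal_mul (Real.exp_pos _).le, expVec, expVec, hx, ← Real.exp_add,
      Real.sqrt_eq_rpow, ← Real.exp_mul]
    congr 2
    rw [norm_smul, mul_pow, Real.norm_eq_abs, sq_abs]
    ring
  rw [lintegral_congr_ae e, lintegral_const_mul _ (measurable_expVec _).ennreal_ofReal,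
    ← ofReal_integral_eq_lintegral_ofReal (integrable_expVec hμ _)
      (ae_of_all _ fun x => (expVec_pos _ x).le), integral_expVec hμ, ENNReal.ofReal_one, mul_one]

/-- For large `h`, the measures `μ_B` and `exp_h μ_B` are almost mutually singular. -/
theorem exists_measurableSet_shiftMeasure_compl_le (hμ : IsGaussianMeasure B μ)
    (h : CameronMartin B) :
    ∃ E : Set H, MeasurableSet E ∧ μ E ≤ ENNReal.ofReal (Real.exp (-‖h‖ ^ 2 / 8)) ∧
      shiftMeasure B μ h Eᶜ ≤ ENNReal.ofReal (Real.exp (-‖h‖ ^ 2 / 8)) := by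
  have hE : MeasurableSet {x | 1 ≤ expVec B μ h x} :=
    measurableSet_le measurable_const (measurable_expVec h)
  refine ⟨_, hE, ?_, ?_⟩
  · rw [← lintegral_sqrt_expVec hμ, ← lintegral_indicator_one hE]
    refine lintegral_mono (Set.indicator_le' (fun y hy => ?_) (fun _ _ => zero_le))
    simpa using hy
  · rw [← lintegral_sqrt_expVec hμ, shiftMeasure, withDensity_apply _ hE.compl]
    refine (setLIntegral_mono' hE.compl fun x hx => ?_).trans (setLIntegral_le_lintegral _ _)
    have h1 : expVec B μ h x < 1 := not_le.1 hx
    exact ENNReal.ofReal_le_ofReal (Real.le_sqrt_of_sq_le (by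
      nlinarith [expVec_pos (μ := μ) h x]))

end Density

/-! ### Measurable extensions of affine isometries -/

theorem countable_of_hilbertBasis {E ι : Type*} [NormedAddCommGroup E] [InnerProductSpace ℝ E]
    [SecondCountableTopology E] (b : HilbertBasis ι ℝ E) : Countable ι := by
  have hd : Pairwise (Function.onFun Disjoint fun i => Metric.ball (b i) (1 / 2)) := by
    intro i j hij
    refine Metric.ball_disjoint_ball ?_
    rw [dist_eq_norm]
    have h1 := norm_sub_sq_real (b i) (b j)
    rw [b.orthonormal.2 hij, b.orthonormal.1, b.orthonormal.1] at h1
    nlinarith [norm_nonneg (b i - b j)]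
  exact hd.countable_of_isOpen_disjoint (fun i => Metric.isOpen_ball)
    fun i => ⟨b i, Metric.mem_ball_self (by norm_num)⟩

section Extension

variable {H : Type*} [NormedAddCommGroup H] [InnerProductSpace ℝ H] [CompleteSpace H]
  [MeasurableSpace H] [BorelSpace H] {B : StrictlyPositiveOperator H} {μ : Measure H}

open CameronMartin

variable [SecondCountableTopology H]

/-- The second moments `‖V (B bᵢ)‖₀² = ⟪B bᵢ, bᵢ⟫` of the coordinates add up to the trace of `B`,
which is the second moment of `μ_B`. -/
theorem ae_summable_sq_measurableFunctional (hμ : IsGaussianMeasure B μ)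
    (V : CameronMartin B ≃ₗᵢ[ℝ] CameronMartin B) {ι : Type*} (b : HilbertBasis ι ℝ H) :
    ∀ᵐ x ∂μ, Summable fun i => measurableFunctional B μ (V (ofOp B (b i))) x ^ 2 := by
  have := countable_of_hilbertBasis b
  have hm : ∀ i, Measurable fun x =>
      ENNReal.ofReal (measurableFunctional B μ (V (ofOp B (b i))) x ^ 2) := fun i =>
    ((measurable_measurableFunctional _).pow_const 2).ennreal_ofReal
  have h1 : ∫⁻ x, ∑' i, ENNReal.ofReal (measurableFunctional B μ (V (ofOp B (b i))) x ^ 2) ∂μ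
      = ∫⁻ x, ENNReal.ofReal (‖x‖ ^ 2) ∂μ := by
    have e : ∀ x : H, ENNReal.ofReal (‖x‖ ^ 2) = ∑' i, ENNReal.ofReal (⟪b i, x⟫ ^ 2) := by
      intro x
      have h2 := b.hasSum_inner_mul_inner x x
      rw [real_inner_self_eq_norm_sq] at h2
      have h3 : ∀ i, ⟪x, b i⟫ * ⟪b i, x⟫ = ⟪b i, x⟫ ^ 2 := fun i => by
        rw [real_inner_comm, pow_two]
      simp only [h3] at h2
      rw [← h2.tsum_eq, ENNReal.ofReal_tsum_of_nonneg (fun i => sq_nonneg _) h2.summable]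
    simp only [e]
    rw [lintegral_tsum fun i => (hm i).aemeasurable, lintegral_tsum fun i => by fun_prop]
    congr 1
    ext i
    rw [lintegral_ofReal_sq_of_map_eq_gaussianReal (aemeasurable_measurableFunctional _)
      (map_measurableFunctional hμ _),
      lintegral_ofReal_sq_of_map_eq_gaussianReal (by fun_prop) (hμ.map_inner (b i)),
      V.nnnorm_map]
  have h2 : ∫⁻ x, ENNReal.ofReal (‖x‖ ^ 2) ∂μ < ⊤ := by
    have h3 := hμ.memLp_two_id.integrable_norm_pow (by norm_num)
    simpa using h3.lintegral_lt_top
  filter_upwards [ae_lt_top (Measurable.tsum hm) (h1 ▸ h2.ne)] with x hx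
  simpa [sq_nonneg] using ENNReal.summable_toReal hx.ne

/-- The inverse of an orthogonal operator `V` of `H₀` extends to a measurable map on `H`. In a
Hilbert basis of `H`, its coordinates are the functionals of `V (B bᵢ)`, which are almost surely
square summable. -/
theorem exists_measurable_inner_eq (hμ : IsGaussianMeasure B μ)
    (V : CameronMartin B ≃ₗᵢ[ℝ] CameronMartin B) :
    ∃ S : H → H, Measurable S ∧
      ∀ u : H, measurableFunctional B μ (V (ofOp B u)) =ᵐ[μ] fun x => ⟪u, S x⟫ := by
  classical
  obtain ⟨w, b, -⟩ := exists_hilbertBasis ℝ H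
  have := countable_of_hilbertBasis b
  let X : w → H → ℝ := fun i => measurableFunctional B μ (V (ofOp B (b i)))
  let S₀ : H → H := fun x =>
    if h : Memℓp (fun i => X i x) 2 then b.repr.symm ⟨fun i => X i x, h⟩ else 0
  have hrepr : ∀ᵐ x ∂μ, ∀ i, b.repr (S₀ x) i = X i x := by
    filter_upwards [ae_summable_sq_measurableFunctional hμ V b] with x hx i
    have h : Memℓp (fun i => X i x) 2 := memℓp_gen (by simpa using hx)
    simp only [S₀, dif_pos h, LinearIsometryEquiv.apply_symm_apply]
  have hS₀ : AEMeasurable S₀ μ := by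
    refine aemeasurable_of_tendsto_metrizable_ae (atTop : Filter (Finset w))
      (f := fun F x => ∑ i ∈ F, X i x • b i) (fun F => ?_) ?_
    · refine Finset.aemeasurable_fun_sum F fun i _ => ?_
      exact (aemeasurable_measurableFunctional _).smul_const _
    · filter_upwards [hrepr] with x hx
      have h := b.hasSum_repr (S₀ x)
      simp only [hx] at h
      exact h
  have hinner : ∀ i, X i =ᵐ[μ] fun x => ⟪b i, hS₀.mk S₀ x⟫ := fun i => by
    filter_upwards [hrepr, hS₀.ae_eq_mk] with x hx hx'
    rw [← hx', ← b.repr_apply_apply, hx]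
  refine ⟨hS₀.mk S₀, hS₀.measurable_mk, fun u => ?_⟩
  have hspan : ∀ u ∈ Submodule.span ℝ (Set.range b),
      measurableFunctional B μ (V (ofOp B u)) =ᵐ[μ] fun x => ⟪u, hS₀.mk S₀ x⟫ := by
    intro u hu
    induction hu using Submodule.span_induction with
    | mem u hu =>
      obtain ⟨i, rfl⟩ := hu
      exact hinner i
    | zero =>
      have h := measurableFunctional_smul (μ := μ) 0 (0 : CameronMartin B)
      simp only [zero_smul, zero_mul] at h
      simpa using h
    | add u v _ _ hu hv =>
      rw [map_add, map_add]
      filter_upwards [hu, hv, measurableFunctional_add (μ := μ) (V (ofOp B u)) (V (ofOp B v))]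
        with x h1 h2 h3
      rw [h3, h1, h2, inner_add_left]
    | smul c u _ hu =>
      rw [map_smul, map_smul]
      filter_upwards [hu, measurableFunctional_smul (μ := μ) c (V (ofOp B u))] with x h1 h2
      rw [h2, h1, real_inner_smul_left]
  have hu : u ∈ (Submodule.span ℝ (Set.range b)).topologicalClosure :=
    b.dense_span ▸ Submodule.mem_top
  obtain ⟨s, hs, hlim⟩ := mem_closure_iff_seq_limit.1 hu
  refine measurableFunctional_eq_of_tendsto (s := fun n => V (ofOp B (s n)))
    (((V.continuous.comp (continuous_ofOp B)).tendsto u).comp hlim) ?_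
  filter_upwards [ae_all_iff.2 fun n => hspan (s n) (hs n)] with x hx
  simp only [hx]
  exact ((continuous_id.inner continuous_const).tendsto u).comp hlim

variable (μ) in
/-- `S` is a measurable map on `H` that plays the role of the inverse of `x ↦ f + V x`, where
`A = (f, V)`. It is specified weakly, by `⟪u, S x⟫ = l_{V B u}(x) - ⟪f, V B u⟫₀` almost everywhere
for each `u`, as `V` need not extend to an operator on `H`. -/
structure IsInverseExtension (A : Aff (CameronMartin B)) (S : H → H) : Prop where
  measurable : Measurable S
  inner_eq : ∀ u : H, ∀ᵐ x ∂μ, ⟪u, S x⟫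
    = measurableFunctional B μ (A.lin (ofOp B u)) x - ⟪A.trans, A.lin (ofOp B u)⟫

theorem exists_isInverseExtension (hμ : IsGaussianMeasure B μ) (A : Aff (CameronMartin B)) :
    ∃ S : H → H, IsInverseExtension μ A S := by
  obtain ⟨S, hS, h⟩ := exists_measurable_inner_eq hμ A.lin
  refine ⟨fun x => S x - incl B (A.lin.symm A.trans), hS.sub_const _, fun u => ?_⟩
  filter_upwards [h u] with x hx
  rw [inner_sub_right, hx, ← inner_ofOp, ← A.lin.inner_map_map, A.lin.apply_symm_apply]

namespace IsInverseExtension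

variable {A : Aff (CameronMartin B)} {S : H → H}

theorem map_shiftMeasure_eq (hμ : IsGaussianMeasure B μ) (hS : IsInverseExtension μ A S) :
    (shiftMeasure B μ A.trans).map S = μ := by
  have := hμ.isProbabilityMeasure
  have := isProbabilityMeasure_shiftMeasure hμ A.trans
  refine Measure.ext_of_charFun (funext fun u => ?_)
  set k := A.lin (ofOp B u) with hk
  have hlaw := map_shiftMeasure hμ A.trans k
  have h1 : charFun (gaussianReal ⟪A.trans, k⟫ (‖k‖₊ ^ 2)) 1
      = ∫ x, Complex.exp (measurableFunctional B μ k x * Complex.I) ∂shiftMeasure B μ A.trans := by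
    rw [← hlaw, charFun_apply_real, integral_map
      (measurable_measurableFunctional k).aemeasurable (by fun_prop)]
    simp
  have h2 : charFun ((shiftMeasure B μ A.trans).map S) u
      = (∫ x, Complex.exp (measurableFunctional B μ k x * Complex.I) ∂shiftMeasure B μ A.trans)
        * Complex.exp (-(⟪A.trans, k⟫ * Complex.I)) := by
    rw [charFun_apply, integral_map hS.measurable.aemeasurable (by fun_prop),
      ← integral_mul_const]
    refine integral_congr_ae ?_
    filter_upwards [(shiftMeasure_absolutelyContinuous _).ae_le (hS.inner_eq u)] with x hx
    rw [real_inner_comm, hx, ← Complex.exp_add]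
    congr 1
    push_cast
    ring
  rw [h2, ← h1, charFun_gaussianReal, hμ.charFun_eq, ← Complex.exp_add, ← norm_ofOp_sq, hk,
    A.lin.nnnorm_map]
  congr 1
  push_cast
  ring

theorem quasiMeasurePreserving (hμ : IsGaussianMeasure B μ) (hS : IsInverseExtension μ A S) :
    Measure.QuasiMeasurePreserving S μ μ := by
  refine ⟨hS.measurable, ?_⟩
  conv_rhs => rw [← hS.map_shiftMeasure_eq hμ]
  exact (absolutelyContinuous_shiftMeasure A.trans).map hS.measurable

theorem measurableFunctional_comp (hμ : IsGaussianMeasure B μ) (hS : IsInverseExtension μ A S)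
    (h : CameronMartin B) :
    ∀ᵐ x ∂μ, measurableFunctional B μ h (S x)
      = measurableFunctional B μ (A.lin h) x - ⟪A.trans, A.lin h⟫ := by
  have hq := hS.quasiMeasurePreserving hμ
  obtain ⟨u, hu, hl⟩ := exists_seq_ofOp_tendsto (μ := μ) h
  have hV : Tendsto (fun n => A.lin (ofOp B (u n))) atTop (𝓝 (A.lin h)) :=
    (A.lin.continuous.tendsto h).comp hu
  have key : measurableFunctional B μ (A.lin h) =ᵐ[μ]
      fun x => measurableFunctional B μ h (S x) + ⟪A.trans, A.lin h⟫ := by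
    refine measurableFunctional_eq_of_tendsto hV ?_
    filter_upwards [hq.ae hl, ae_all_iff.2 fun n => hS.inner_eq (u n),
      ae_all_iff.2 fun n => hq.ae (measurableFunctional_ofOp hμ (u n))] with x h1 h2 h3
    refine (h1.add (Tendsto.inner (tendsto_const_nhds (x := A.trans)) hV)).congr fun n => ?_
    rw [h3, h2, sub_add_cancel]
  filter_upwards [key] with x hx
  rw [hx, add_sub_cancel_right]

/-- The extensions of `A` and of `A⁻¹` are inverse to each other almost everywhere. -/
theorem ae_comp_eq (hμ : IsGaussianMeasure B μ) (hS : IsInverseExtension μ A S) {S' : H → H}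
    (hS' : IsInverseExtension μ A⁻¹ S') : ∀ᵐ x ∂μ, S (S' x) = x := by
  have hlin : ∀ h, A⁻¹.lin (A.lin h) = h := A.lin.symm_apply_apply
  have key : ∀ u : H, ∀ᵐ x ∂μ, ⟪u, S (S' x)⟫ = ⟪u, x⟫ := fun u => by
    filter_upwards [(hS'.quasiMeasurePreserving hμ).ae (hS.inner_eq u),
      hS'.measurableFunctional_comp hμ (A.lin (ofOp B u)), measurableFunctional_ofOp hμ u]
      with x h1 h2 h3
    have h4 : ⟪A⁻¹.trans, ofOp B u⟫ = -⟪A.trans, A.lin (ofOp B u)⟫ := by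
      change ⟪-(A.lin.symm A.trans), ofOp B u⟫ = _
      rw [inner_neg_left, ← A.lin.inner_map_map, A.lin.apply_symm_apply]
    rw [h1, h2, hlin, h3, h4]
    ring
  filter_upwards [ae_all_iff.2 fun n => key (TopologicalSpace.denseSeq H n)] with x hx
  refine ext_inner_left ℝ fun v => ?_
  have hc : ∀ y : H, Continuous fun v : H => ⟪v, y⟫ := fun y => by fun_prop
  exact congrFun ((TopologicalSpace.denseRange_denseSeq H).equalizer (hc _) (hc _) (funext hx)) v

end IsInverseExtension

end Extension

/-! ### Almost everywhere inverse maps -/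

/-- Measurable maps that are inverse to each other almost everywhere agree almost everywhere with
an everywhere invertible Borel transformation and its inverse, as soon as there is an uncountable
null set. -/
theorem exists_measurableEquiv_ae_eq {X : Type*} [MeasurableSpace X] [StandardBorelSpace X]
    {μ : Measure X} {S S' : X → X} (hS : Measure.QuasiMeasurePreserving S μ μ)
    (hS' : Measure.QuasiMeasurePreserving S' μ μ) (h : ∀ᵐ x ∂μ, S' (S x) = x)
    (h' : ∀ᵐ x ∂μ, S (S' x) = x) {N : Set X} (hN : MeasurableSet N) (hN0 : μ N = 0)
    (hNc : ¬ N.Countable) :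
    ∃ T : X ≃ᵐ X, T =ᵐ[μ] S ∧ T.symm =ᵐ[μ] S' := by
  classical
  have hae : ∀ᵐ x ∂μ, x ∉ N := measure_eq_zero_iff_ae_notMem.1 hN0
  -- Keeping `N` out of both sets makes both complements uncountable, hence Borel isomorphic.
  let E : Set X := {x | S' (S x) = x ∧ x ∉ N ∧ S x ∉ N}
  let F : Set X := {x | S (S' x) = x ∧ x ∉ N ∧ S' x ∉ N}
  have hEm : MeasurableSet E :=
    (measurableSet_eq_fun (hS'.measurable.comp hS.measurable) measurable_id).inter
      (hN.compl.inter (hS.measurable hN.compl))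
  have hFm : MeasurableSet F :=
    (measurableSet_eq_fun (hS.measurable.comp hS'.measurable) measurable_id).inter
      (hN.compl.inter (hS'.measurable hN.compl))
  have hE : ∀ᵐ x ∂μ, x ∈ E := by
    filter_upwards [h, hae, hS.ae hae] with x h1 h2 h3 using ⟨h1, h2, h3⟩
  have hF : ∀ᵐ x ∂μ, x ∈ F := by
    filter_upwards [h', hae, hS'.ae hae] with x h1 h2 h3 using ⟨h1, h2, h3⟩
  have hSE : ∀ x ∈ E, S x ∈ F := fun x hx =>
    ⟨congrArg S hx.1, hx.2.2, by rw [hx.1]; exact hx.2.1⟩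
  have hSF : ∀ x ∈ F, S' x ∈ E := fun x hx =>
    ⟨congrArg S' hx.1, hx.2.2, by rw [hx.1]; exact hx.2.1⟩
  have hEc : ¬ Countable (Eᶜ : Set X) := fun hc =>
    hNc ((Set.countable_coe_iff.1 hc).mono fun x hx (hxE : x ∈ E) => hxE.2.1 hx)
  have hFc : ¬ Countable (Fᶜ : Set X) := fun hc =>
    hNc ((Set.countable_coe_iff.1 hc).mono fun x hx (hxF : x ∈ F) => hxF.2.1 hx)
  have := hEm.compl.standardBorel
  have := hFm.compl.standardBorel
  let e : E ≃ᵐ F :=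
    { toFun := fun x => ⟨S x, hSE x x.2⟩
      invFun := fun x => ⟨S' x, hSF x x.2⟩
      left_inv := fun x => Subtype.ext x.2.1
      right_inv := fun x => Subtype.ext x.2.1
      measurable_toFun := (hS.measurable.comp measurable_subtype_coe).subtype_mk
      measurable_invFun := (hS'.measurable.comp measurable_subtype_coe).subtype_mk }
  let T : X ≃ᵐ X := (MeasurableEquiv.sumCompl hEm).symm.trans
    ((e.sumCongr (PolishSpace.measurableEquivOfNotCountable hEc hFc)).trans
      (MeasurableEquiv.sumCompl hFm))
  have hT : ∀ x ∈ E, T x = S x := by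
    intro x hx
    have h1 : (MeasurableEquiv.sumCompl hEm).symm x = Sum.inl ⟨x, hx⟩ :=
      (MeasurableEquiv.sumCompl hEm).symm_apply_eq.2 rfl
    change MeasurableEquiv.sumCompl hFm ((e.sumCongr _) ((MeasurableEquiv.sumCompl hEm).symm x))
      = S x
    rw [h1]
    rfl
  refine ⟨T, ?_, ?_⟩
  · filter_upwards [hE] with x hx using hT x hx
  · filter_upwards [hF] with x hx
    rw [MeasurableEquiv.symm_apply_eq, hT _ (hSF x hx), hx.1]

/-! ### Fixed points of affine isometries -/

/-- A bounded sequence in a Hilbert space has a Chebyshev centre: a unique point at which the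
supremum of the squared distances to the members of the sequence is minimal. -/
theorem exists_chebyshev_center {K ι : Type*} [NormedAddCommGroup K] [InnerProductSpace ℝ K]
    [CompleteSpace K] [Nonempty ι] {s : ι → K} (hs : Bornology.IsBounded (Set.range s)) :
    ∃ (r : ℝ) (x : K), (∀ i, ‖x - s i‖ ^ 2 ≤ r) ∧
      ∀ y, (∀ i, ‖y - s i‖ ^ 2 ≤ r) → y = x := by
  let R : Set ℝ := {r | ∃ x, ∀ i, ‖x - s i‖ ^ 2 ≤ r}
  have hbelow : BddBelow R := ⟨0, fun r ⟨x, hx⟩ => (sq_nonneg _).trans (hx (Classical.arbitrary ι))⟩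
  have hR : R.Nonempty := by
    obtain ⟨C, hC⟩ := isBounded_iff_forall_norm_le.1 hs
    refine ⟨C ^ 2, 0, fun i => ?_⟩
    rw [zero_sub, norm_neg]
    have := hC _ ⟨i, rfl⟩
    gcongr
  -- The parallelogram identity for the midpoint of `x` and `y`.
  have key : ∀ r x y, (∀ i, ‖x - s i‖ ^ 2 ≤ r) → (∀ i, ‖y - s i‖ ^ 2 ≤ r) →
      ‖x - y‖ ^ 2 ≤ 4 * (r - sInf R) := by
    intro r x y hx hy
    have h1 : r - ‖x - y‖ ^ 2 / 4 ∈ R := by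
      refine ⟨(2⁻¹ : ℝ) • (x + y), fun i => ?_⟩
      have h2 := parallelogram_law_with_norm ℝ (x - s i) (y - s i)
      have h3 : (2⁻¹ : ℝ) • (x + y) - s i = (2⁻¹ : ℝ) • ((x - s i) + (y - s i)) := by
        module
      rw [sub_sub_sub_cancel_right] at h2
      rw [h3, norm_smul, mul_pow, Real.norm_of_nonneg (by norm_num)]
      nlinarith [hx i, hy i]
    have h2 := csInf_le hbelow h1
    linarith
  have happrox : ∀ n : ℕ, ∃ x, ∀ i, ‖x - s i‖ ^ 2 ≤ sInf R + 1 / (n + 1 : ℝ) := fun n => by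
    obtain ⟨r, ⟨x, hx⟩, hr⟩ := exists_lt_of_csInf_lt hR
      (lt_add_of_pos_right (sInf R) (by positivity : 0 < 1 / (n + 1 : ℝ)))
    exact ⟨x, fun i => (hx i).trans hr.le⟩
  choose x hx using happrox
  have hcau : CauchySeq x := by
    refine cauchySeq_of_le_tendsto_0 (fun n : ℕ => Real.sqrt (4 * (1 / (n + 1 : ℝ)))) ?_ ?_
    · intro n m N hn hm
      have hmono : ∀ {k}, N ≤ k → ∀ i, ‖x k - s i‖ ^ 2 ≤ sInf R + 1 / (N + 1 : ℝ) :=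
        fun hk i => (hx _ i).trans (add_le_add_right (Nat.one_div_le_one_div hk) _)
      rw [dist_eq_norm]
      refine Real.le_sqrt_of_sq_le ?_
      simpa using key _ _ _ (hmono hn) (hmono hm)
    · have h1 := (tendsto_one_div_add_atTop_nhds_zero_nat (𝕜 := ℝ)).const_mul 4
      rw [mul_zero] at h1
      simpa only [Real.sqrt_zero] using! (Real.continuous_sqrt.tendsto 0).comp h1
  obtain ⟨a, ha⟩ := cauchySeq_tendsto_of_complete hcau
  have hmin : ∀ i, ‖a - s i‖ ^ 2 ≤ sInf R := fun i => by
    have h1 := (tendsto_one_div_add_atTop_nhds_zero_nat (𝕜 := ℝ)).const_add (sInf R)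
    rw [add_zero] at h1
    exact le_of_tendsto_of_tendsto' ((ha.sub_const (s i)).norm.pow 2) h1 fun n => hx n i
  refine ⟨sInf R, a, hmin, fun y hy => ?_⟩
  have h1 := key _ _ _ hy hmin
  rw [sub_self, mul_zero] at h1
  exact sub_eq_zero.1 (norm_eq_zero.1 (pow_eq_zero_iff two_ne_zero |>.1
    (le_antisymm h1 (sq_nonneg _))))

namespace Aff

variable {K : Type*} [NormedAddCommGroup K] [InnerProductSpace ℝ K]

theorem mul_trans (A A' : Aff K) : (A * A').trans = A.act A'.trans := rfl

theorem mul_act (A A' : Aff K) (h : K) : (A * A').act h = A.act (A'.act h) := by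
  change A.trans + A.lin A'.trans + A.lin (A'.lin h) = A.trans + A.lin (A'.trans + A'.lin h)
  rw [map_add, add_assoc]

theorem one_act (h : K) : (1 : Aff K).act h = h := zero_add h

theorem act_sub_act (A : Aff K) (x y : K) : A.act x - A.act y = A.lin (x - y) := by
  rw [act, act, map_sub, add_sub_add_left_eq_sub]

theorem norm_inv_trans (A : Aff K) : ‖A⁻¹.trans‖ = ‖A.trans‖ :=
  (norm_neg _).trans (A.lin⁻¹.norm_map _)

theorem zpow_act_eq_of_act_eq {A : Aff K} {a : K} (ha : A.act a = a) (n : ℤ) :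
    (A ^ n).act a = a := by
  let _ : MulAction (Aff K) K :=
    { smul := act, one_smul := one_act, mul_smul := mul_act }
  exact zpow_mem (show A ∈ MulAction.stabilizer (Aff K) a from ha) n

/-- The translation parts of the powers of `A` form the orbit of `0`. If this orbit is bounded,
then its Chebyshev centre is fixed by `A`. -/
theorem exists_act_eq_iff_isBounded [CompleteSpace K] (A : Aff K) :
    (∃ a, A.act a = a) ↔ Bornology.IsBounded (Set.range fun n : ℤ => (A ^ n).trans) := by
  constructor
  · rintro ⟨a, ha⟩
    refine isBounded_iff_forall_norm_le.2 ⟨‖a‖ + ‖a‖, ?_⟩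
    rintro _ ⟨n, rfl⟩
    have h : (A ^ n).trans = a - (A ^ n).lin a :=
      eq_sub_of_add_eq (zpow_act_eq_of_act_eq ha n)
    simp only [h]
    exact (norm_sub_le _ _).trans_eq (by rw [LinearIsometryEquiv.norm_map])
  · intro hb
    obtain ⟨r, a, ha, huniq⟩ := exists_chebyshev_center hb
    refine ⟨a, huniq _ fun n => ?_⟩
    have h : (A ^ n).trans = A.act (A ^ (n - 1)).trans := by
      rw [← mul_trans, ← zpow_one_add, add_sub_cancel]
    rw [h, act_sub_act, LinearIsometryEquiv.norm_map]
    exact ha (n - 1)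

theorem exists_act_eq_iff_isCoboundary (A : Aff K) :
    (∃ a, A.act a = a) ↔ IsCoboundary A.lin A.trans :=
  exists_congr fun _ => eq_sub_iff_add_eq.symm

/-- As `(f, V)⁻¹ = (-V⁻¹ f, V⁻¹)`, it suffices to bound the positive powers. -/
theorem isBounded_of_forall_nat {A : Aff K} {C : ℝ} (h : ∀ n : ℕ, ‖(A ^ n).trans‖ ≤ C) :
    Bornology.IsBounded (Set.range fun n : ℤ => (A ^ n).trans) := by
  refine isBounded_iff_forall_norm_le.2 ⟨C, ?_⟩
  rintro _ ⟨n, rfl⟩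
  obtain ⟨m, rfl | rfl⟩ := n.eq_nat_or_neg
  · simpa using h m
  · simpa [norm_inv_trans] using h m

end Aff

/-! ### Gaussian transformations -/

theorem map_withDensity {X : Type*} [MeasurableSpace X] {μ : Measure X} (T : X ≃ᵐ X)
    {g : X → ENNReal} :
    (μ.withDensity g).map T = (μ.map T).withDensity (g ∘ T.symm) := by
  ext E hE
  rw [Measure.map_apply T.measurable hE, withDensity_apply _ (T.measurable hE),
    withDensity_apply _ hE, Measure.restrict_map T.measurable hE, lintegral_map_equiv]
  simp

theorem IsNonsingular.quasiMeasurePreserving_symm {X : Type*} [MeasurableSpace X]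
    {μ : Measure X} {T : X ≃ᵐ X} (hT : IsNonsingular μ T) :
    Measure.QuasiMeasurePreserving T.symm μ μ := by
  refine ⟨T.symm.measurable, ?_⟩
  have h := hT.2.map T.symm.measurable
  rwa [T.map_symm_map] at h

section Transformation

variable {H : Type*} [NormedAddCommGroup H] [InnerProductSpace ℝ H] [CompleteSpace H]
  [MeasurableSpace H] [BorelSpace H] {B : StrictlyPositiveOperator H} {μ : Measure H}
  {A : Aff (CameronMartin B)} {T : H ≃ᵐ H}

open CameronMartin

theorem sqrt_expVec (h : CameronMartin B) (x : H) : Real.sqrt (expVec B μ h x)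
    = Real.exp ((measurableFunctional B μ h x - ‖h‖ ^ 2 / 2) / 2) := by
  rw [expVec, Real.exp_half]

/-- The Weyl operator of `(f / 2, V)` splits into the composition of `exp_h` with the inverse of
`x ↦ f + V x` and the square root of the density `exp_f`. -/
theorem weylExpVec_scale_half (A : Aff (CameronMartin B)) (h : CameronMartin B) :
    weylExpVec B μ (A.scale (1 / 2)) h =ᵐ[μ] fun x =>
      Real.exp (measurableFunctional B μ (A.lin h) x - ⟪A.trans, A.lin h⟫ - ‖h‖ ^ 2 / 2)
        * Real.sqrt (expVec B μ A.trans x) := by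
  filter_upwards [measurableFunctional_add (μ := μ) ((1 / 2 : ℝ) • A.trans) (A.lin h),
    measurableFunctional_smul (μ := μ) (1 / 2) A.trans] with x h1 h2
  rw [sqrt_expVec, ← Real.exp_add]
  change Real.exp (-⟪(1 / 2 : ℝ) • A.trans, A.lin h⟫ - ‖(1 / 2 : ℝ) • A.trans‖ ^ 2 / 2)
    * Real.exp (measurableFunctional B μ ((1 / 2 : ℝ) • A.trans + A.lin h) x
      - ‖(1 / 2 : ℝ) • A.trans + A.lin h‖ ^ 2 / 2) = _
  rw [← Real.exp_add, h1, h2, norm_add_sq_real, norm_smul, mul_pow, Real.norm_eq_abs, sq_abs,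
    real_inner_smul_left, A.lin.norm_map]
  congr 1
  ring

variable [SecondCountableTopology H]

namespace IsGaussianTransformation

theorem map_eq (hμ : IsGaussianMeasure B μ) (hT : IsGaussianTransformation B μ A T) :
    μ.map T = shiftMeasure B μ A.trans := by
  have := hμ.isProbabilityMeasure
  have : IsProbabilityMeasure (μ.map T) :=
    Measure.isProbabilityMeasure_map T.measurable.aemeasurable
  have hzero := measurableFunctional_smul (μ := μ) 0 (0 : CameronMartin B)
  simp only [zero_smul, zero_mul] at hzero
  rw [← Measure.withDensity_rnDeriv_eq _ _ hT.1.1]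
  refine shiftMeasure_congr ?_
  filter_upwards [hT.2 0, weylExpVec_scale_half A (0 : CameronMartin B), hzero,
    hT.1.quasiMeasurePreserving_symm.ae hzero, Measure.rnDeriv_lt_top (μ.map T) μ]
    with x h1 h2 h3 h4 h5
  rw [h2, map_zero, koopman, expVec, h3, h4] at h1
  simp only [norm_zero, inner_zero_right, ne_eq, OfNat.ofNat_ne_zero, not_false_eq_true, zero_pow,
    zero_div, sub_zero, Real.exp_zero, one_mul] at h1
  rw [Real.sqrt_inj ENNReal.toReal_nonneg (expVec_pos _ x).le] at h1
  rw [← h1, ENNReal.ofReal_toReal h5.ne]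

theorem measurableFunctional_symm (hμ : IsGaussianMeasure B μ)
    (hT : IsGaussianTransformation B μ A T) (h : CameronMartin B) :
    ∀ᵐ x ∂μ, measurableFunctional B μ h (T.symm x)
      = measurableFunctional B μ (A.lin h) x - ⟪A.trans, A.lin h⟫ := by
  have := hμ.isProbabilityMeasure
  have hρ : (μ.map T).rnDeriv μ =ᵐ[μ] fun x => ENNReal.ofReal (expVec B μ A.trans x) := by
    rw [hT.map_eq hμ]
    exact Measure.rnDeriv_withDensity μ (measurable_expVec _).ennreal_ofReal
  filter_upwards [hT.2 h, weylExpVec_scale_half A h, hρ] with x h1 h2 h3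
  rw [h2, koopman, h3, ENNReal.toReal_ofReal (expVec_pos _ x).le] at h1
  have h4 := mul_right_cancel₀ (Real.sqrt_pos.2 (expVec_pos A.trans x)).ne' h1
  rw [expVec, Real.exp_eq_exp] at h4
  linarith

/-- The transformation `T_A` acts on the measures `exp_a μ_B` as `A` acts on `H₀`. -/
theorem map_shiftMeasure_act (hμ : IsGaussianMeasure B μ) (hT : IsGaussianTransformation B μ A T)
    (a : CameronMartin B) :
    (shiftMeasure B μ a).map T = shiftMeasure B μ (A.act a) := by
  have hm : Measurable ((fun x => ENNReal.ofReal (expVec B μ a x)) ∘ T.symm) :=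
    (measurable_expVec a).ennreal_ofReal.comp T.symm.measurable
  rw [shiftMeasure, map_withDensity, hT.map_eq hμ, shiftMeasure,
    ← withDensity_mul _ (measurable_expVec _).ennreal_ofReal hm]
  refine shiftMeasure_congr ?_
  filter_upwards [hT.measurableFunctional_symm hμ a,
    measurableFunctional_add (μ := μ) A.trans (A.lin a)] with x h1 h2
  change ENNReal.ofReal (expVec B μ A.trans x) * ENNReal.ofReal (expVec B μ a (T.symm x))
    = ENNReal.ofReal (Real.exp (measurableFunctional B μ (A.trans + A.lin a) x
      - ‖A.trans + A.lin a‖ ^ 2 / 2))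
  rw [← ENNReal.ofReal_mul (expVec_pos _ x).le, expVec, expVec, ← Real.exp_add, h1, h2,
    norm_add_sq_real, A.lin.norm_map]
  congr 2
  ring

theorem map_iterate (hμ : IsGaussianMeasure B μ) (hT : IsGaussianTransformation B μ A T) (n : ℕ) :
    μ.map T^[n] = shiftMeasure B μ (A ^ n).trans := by
  induction n with
  | zero =>
    rw [Function.iterate_zero, Measure.map_id]
    exact shiftMeasure_zero.symm
  | succ n ih =>
    rw [Function.iterate_succ', ← Measure.map_map T.measurable (T.measurable.iterate n), ih,
      hT.map_shiftMeasure_act hμ, pow_succ', Aff.mul_trans]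

theorem hasEquivInvariantProbability_of_act_eq (hμ : IsGaussianMeasure B μ)
    (hT : IsGaussianTransformation B μ A T) {a : CameronMartin B} (ha : A.act a = a) :
    HasEquivInvariantProbability μ T :=
  ⟨shiftMeasure B μ a, isProbabilityMeasure_shiftMeasure hμ a, shiftMeasure_absolutelyContinuous a,
    absolutelyContinuous_shiftMeasure a, T.measurable, by rw [hT.map_shiftMeasure_act hμ, ha]⟩

/-- If `ν ≪ μ_B` is invariant, then the measures `exp_{f⁽ⁿ⁾} μ_B = μ_B ∘ T⁻ⁿ` stay away from being
singular to `μ_B`, which bounds the norms of the `f⁽ⁿ⁾`. -/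
theorem isBounded_trans_of_invariant (hμ : IsGaussianMeasure B μ)
    (hT : IsGaussianTransformation B μ A T) {ν : Measure H} [IsProbabilityMeasure ν] (hν : ν ≪ μ)
    (hinv : MeasurePreserving T ν ν) :
    Bornology.IsBounded (Set.range fun n : ℤ => (A ^ n).trans) := by
  have := hμ.isProbabilityMeasure
  have hfin : ∫⁻ x, ν.rnDeriv μ x ∂μ ≠ ⊤ := (Measure.lintegral_rnDeriv_lt_top ν μ).ne
  obtain ⟨δ, hδ, hlt⟩ := exists_pos_setLIntegral_lt_of_measure_lt hfin
    (ε := 2⁻¹) (by simp)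
  have hsmall : ∀ E, μ E < δ → ν E < 2⁻¹ := fun E hE => by
    have h := hlt E hE
    rwa [Measure.setLIntegral_rnDeriv hν] at h
  -- For large `n` both `E` and its complement would have `ν`-measure less than `1 / 2`.
  have hδn : ∀ n : ℕ, δ ≤ ENNReal.ofReal (Real.exp (-‖(A ^ n).trans‖ ^ 2 / 8)) := by
    intro n
    by_contra! hn
    obtain ⟨E, hE, h1, h2⟩ := exists_measurableSet_shiftMeasure_compl_le hμ (A ^ n).trans
    rw [← hT.map_iterate hμ, Measure.map_apply (T.measurable.iterate n) hE.compl] at h2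
    have h3 := hsmall _ (h1.trans_lt hn)
    have h4 := hsmall _ (h2.trans_lt hn)
    rw [(hinv.iterate n).measure_preimage hE.compl.nullMeasurableSet] at h4
    have h5 := ENNReal.add_lt_add h3 h4
    rw [measure_add_measure_compl hE, measure_univ, ENNReal.inv_two_add_inv_two] at h5
    exact lt_irrefl _ h5
  have hδtop : δ ≠ ⊤ := ne_top_of_le_ne_top ENNReal.ofReal_ne_top (hδn 0)
  refine Aff.isBounded_of_forall_nat (C := Real.sqrt (8 * -Real.log δ.toReal)) fun n => ?_
  refine Real.le_sqrt_of_sq_le ?_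
  have h1 := ENNReal.toReal_mono ENNReal.ofReal_ne_top (hδn n)
  rw [ENNReal.toReal_ofReal (Real.exp_pos _).le,
    ← Real.log_le_iff_le_exp (ENNReal.toReal_pos hδ.ne' hδtop)] at h1
  linarith

end IsGaussianTransformation

/-- Hyperplanes are null sets, since continuous linear functionals have nondegenerate laws. -/
theorem measure_orthogonal_eq_zero (hμ : IsGaussianMeasure B μ) {u : H} (hu : u ≠ 0) :
    μ {x | ⟪u, x⟫ = 0} = 0 := by
  have hv : ‖ofOp B u‖₊ ^ 2 ≠ 0 := by
    refine pow_ne_zero 2 (nnnorm_ne_zero_iff.2 fun h => ?_)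
    have h1 := norm_ofOp_sq B u
    rw [h, norm_zero] at h1
    have := B.inner_pos u hu
    norm_num at h1
    linarith
  have := nullSingletonClass_gaussianReal (μ := 0) hv
  have h := measure_singleton (μ := gaussianReal 0 (‖ofOp B u‖₊ ^ 2)) (0 : ℝ)
  rwa [← hμ.map_inner, Measure.map_apply (by fun_prop) (measurableSet_singleton 0)] at h

/-- An invertible Borel transformation is a version of `T_A` as soon as its inverse agrees almost
everywhere with a measurable inverse extension of `A`: the density of `μ_B ∘ T⁻¹` is then `exp_f`. -/
theorem IsInverseExtension.isGaussianTransformation (hμ : IsGaussianMeasure B μ)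
    {S : H → H} (hS : IsInverseExtension μ A S) (hT : T.symm =ᵐ[μ] S) :
    IsGaussianTransformation B μ A T := by
  have := hμ.isProbabilityMeasure
  have hmap : μ.map T = shiftMeasure B μ A.trans := by
    have h1 : (shiftMeasure B μ A.trans).map T.symm = μ := by
      rw [Measure.map_congr ((shiftMeasure_absolutelyContinuous _).ae_eq hT),
        hS.map_shiftMeasure_eq hμ]
    conv_lhs => rw [← h1]
    rw [MeasurableEquiv.map_map_symm]
  refine ⟨⟨?_, ?_⟩, fun h => ?_⟩
  · rw [hmap]; exact shiftMeasure_absolutelyContinuous _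
  · rw [hmap]; exact absolutelyContinuous_shiftMeasure _
  have hρ : (μ.map T).rnDeriv μ =ᵐ[μ] fun x => ENNReal.ofReal (expVec B μ A.trans x) := by
    rw [hmap]
    exact Measure.rnDeriv_withDensity μ (measurable_expVec _).ennreal_ofReal
  filter_upwards [weylExpVec_scale_half A h, hρ, hT, hS.measurableFunctional_comp hμ h]
    with x h1 h2 h3 h4
  rw [h1, koopman, h2, ENNReal.toReal_ofReal (expVec_pos _ x).le, h3, expVec, h4]

theorem exists_isGaussianTransformation (hμ : IsGaussianMeasure B μ) (hH : ¬ FiniteDimensional ℝ H)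
    (A : Aff (CameronMartin B)) : ∃ T : H ≃ᵐ H, IsGaussianTransformation B μ A T := by
  obtain ⟨S, hS⟩ := exists_isInverseExtension hμ A
  obtain ⟨S', hS'⟩ := exists_isInverseExtension hμ A⁻¹
  have h : ∀ᵐ x ∂μ, S' (S x) = x := hS'.ae_comp_eq hμ ((inv_inv A).symm ▸ hS)
  have h' : ∀ᵐ x ∂μ, S (S' x) = x := hS.ae_comp_eq hμ hS'
  obtain ⟨u, hu⟩ : ∃ u : H, u ≠ 0 := by
    by_contra! h0
    have : Subsingleton H := ⟨fun x y => by rw [h0 x, h0 y]⟩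
    exact hH inferInstance
  obtain ⟨v, hv, hv0⟩ : ∃ v : H, ⟪u, v⟫ = 0 ∧ v ≠ 0 := by
    by_contra! h0
    have h1 : (ℝ ∙ u)ᗮ = ⊥ := (Submodule.eq_bot_iff _).2 fun v hv =>
      h0 v (Submodule.mem_orthogonal_singleton_iff_inner_right.1 hv)
    rw [Submodule.orthogonal_eq_bot_iff] at h1
    exact hH (Module.finite_def.2 (h1 ▸ Submodule.fg_span_singleton u))
  have hN : MeasurableSet {x : H | ⟪u, x⟫ = 0} :=
    measurableSet_eq_fun (by fun_prop) measurable_const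
  have hNc : ¬ {x : H | ⟪u, x⟫ = 0}.Countable := fun hc => by
    have h1 : (Set.univ : Set ℝ).Countable := by
      refine Set.MapsTo.countable_of_injOn (f := fun t : ℝ => t • v) (fun t _ => ?_)
        (smul_left_injective ℝ hv0).injOn hc
      change ⟪u, t • v⟫ = 0
      rw [real_inner_smul_right, hv, mul_zero]
    exact Cardinal.not_countable_real h1
  obtain ⟨T, hT, hT'⟩ := exists_measurableEquiv_ae_eq (hS'.quasiMeasurePreserving hμ)
    (hS.quasiMeasurePreserving hμ) h' h hN (measure_orthogonal_eq_zero hμ hu) hNc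
  exact ⟨T, hS.isGaussianTransformation hμ hT'⟩

end Transformation

end NonsingularGaussian

theorem theorem3p9 {H : Type*} [NormedAddCommGroup H] [InnerProductSpace ℝ H] [CompleteSpace H]
    [TopologicalSpace.SeparableSpace H] [MeasurableSpace H] [BorelSpace H]
    (hH : ¬ FiniteDimensional ℝ H)
    (B : NonsingularGaussian.StrictlyPositiveOperator H) (μ : Measure H)
    (hμ : NonsingularGaussian.IsGaussianMeasure B μ)
    (A : NonsingularGaussian.Aff (NonsingularGaussian.CameronMartin B)) :
    (∃ T : H ≃ᵐ H, NonsingularGaussian.IsGaussianTransformation B μ A T) ∧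
    ∀ T : H ≃ᵐ H, NonsingularGaussian.IsGaussianTransformation B μ A T →
      List.TFAE [
        NonsingularGaussian.HasEquivInvariantProbability μ T,
        NonsingularGaussian.IsCoboundary A.lin A.trans,
        ∃ a : NonsingularGaussian.CameronMartin B, A.act a = a,
        Bornology.IsBounded (Set.range fun n : ℤ => (A ^ n).trans)] := by
  have := UniformSpace.secondCountable_of_separable H
  refine ⟨NonsingularGaussian.exists_isGaussianTransformation hμ hH A, fun T hT => ?_⟩
  tfae_have 1 → 4 := fun ⟨ν, _, hν, _, hinv⟩ => hT.isBounded_trans_of_invariant hμ hν hinv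
  tfae_have 3 ↔ 4 := A.exists_act_eq_iff_isBounded
  tfae_have 3 ↔ 2 := A.exists_act_eq_iff_isCoboundary
  tfae_have 3 → 1 := fun ⟨_, ha⟩ => hT.hasEquivInvariantProbability_of_act_eq hμ ha
  tfae_finish
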